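/- Let $K:\mathbb R\to[0,\infty)$ be a kernel and, for a bandwidth $h>0$, put $K_h(t)=h^{-1}K(t/h)$. The Nadaraya–Watson smoother with design points $x_1,\dots,x_n\in\mathbb R$ is the matrix $S$ with entries $S_{ij}=K_h(x_i-x_j)/\sum_{k=1}^n K_h(x_i-x_k)$ (with $0/0=0$). Spectra are taken over $\mathbb C$. (i) If there is a finite positive Borel measure $\nu$ on $\mathbb R$ with $K(x)=\int e^{-2\pi i x t}\,\nu(dt)$ for all $x\in\mathbb R$ (that is, the inverse Fourier–Stieltjes transform of $K$ is a positive finite measure), then for every $n$, all $x_1,\dots,x_n\in\mathbb R$ and every $h>0$ the spectrum of $S$ lies in $[0,1]$. (ii) Conversely, let $K$ be moreover symmetric ($K(-x)=K(x)$ for all $x$), measurable and Lebesgue integrable, and suppose that $K$ does not agree Lebesgue-almost everywhere with any function of the form $x\mapsto\int e^{-2\pi i x t}\,\nu(dt)$ with $\nu$ a finite positive Borel measure. Let $f$ be a probability density on $\mathbb R$ with respect to Lebesgue measure such that $f\ge c$ on $C$ for some $c>0$ and some compact set $C$ of positive Lebesgue measure. Then there is $h_0>0$, depending only on $K,f,C,c$,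 such that for every fixed bandwidth $h\in(0,h_0)$ the following holds: if $X_1,X_2,\dots$ are independent random variables with density $f$ and $S$ is the Nadaraya–Watson smoother with bandwidth $h$ and design points $X_1,\dots,X_n$, then with probability tending to one as $n\to\infty$ the spectrum of $I-S$ is real and its maximum exceeds $1$. -/

import Mathlib

open MeasureTheory ProbabilityTheory Filter Topology

noncomputable section

/-- The function `K` on the line is the Fourier–Stieltjes transform
`K x = ∫ exp (-2 π i x t) ν(dt)` of some finite positive Borel measure `ν`; equivalently `ν` is the
inverse Fourier–Stieltjes transform of `K`. -/
def IsTransformOfPosFiniteMeasure (K : ℝ → ℝ) : Prop :=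
  ∃ ν : Measure ℝ, IsFiniteMeasure ν ∧
    ∀ x : ℝ, (K x : ℂ) = ∫ t : ℝ, Complex.exp (-2 * Real.pi * Complex.I * x * t) ∂ν

/-- The scaled kernel `K_h t = h⁻¹ K (t / h)`. -/
def scaledKernel (K : ℝ → ℝ) (h t : ℝ) : ℝ := h⁻¹ * K (t / h)

/-- The smoothing matrix of the Nadaraya–Watson smoother with kernel `K`, bandwidth `h` and design
points `x 0, …, x (n - 1)`.  A row whose weights all vanish is zero (`0 / 0 = 0`); there is no such
row when `K` is nonnegative and `K 0 > 0`. -/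
def nwMatrix (K : ℝ → ℝ) (h : ℝ) {n : ℕ} (x : Fin n → ℝ) : Matrix (Fin n) (Fin n) ℝ :=
  Matrix.of fun i j => scaledKernel K h (x i - x j) / ∑ k, scaledKernel K h (x i - x k)

/-- The spectrum of a real square matrix: all its complex eigenvalues. -/
def complexSpectrum {n : ℕ} (M : Matrix (Fin n) (Fin n) ℝ) : Set ℂ :=
  spectrum ℂ (M.map (algebraMap ℝ ℂ))

/-- All the complex eigenvalues of `M` are real, and `r` is the largest of them. -/
def IsMaxOfSpectrum {n : ℕ} (M : Matrix (Fin n) (Fin n) ℝ) (r : ℝ) : Prop :=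
  (r : ℂ) ∈ complexSpectrum M ∧ ∀ z ∈ complexSpectrum M, ∃ s : ℝ, z = (s : ℂ) ∧ s ≤ r

/-- `f` is a probability density on the line with respect to Lebesgue measure. -/
structure IsProbDensity (f : ℝ → ℝ) : Prop where
  measurable : Measurable f
  nonneg : ∀ x, 0 ≤ f x
  lintegral_eq_one : ∫⁻ x, ENNReal.ofReal (f x) = 1

/-- `X 0, X 1, …` are independent random variables on `(Ω, P)`, each with the density `f`. -/
structure IsIIDWithDensity {Ω : Type*} [MeasurableSpace Ω] (P : Measure Ω) (X : ℕ → Ω → ℝ)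
    (f : ℝ → ℝ) : Prop where
  measurable : ∀ i, Measurable (X i)
  indep : iIndepFun X P
  law : ∀ i, P.map (X i) = volume.withDensity fun x => ENNReal.ofReal (f x)

end

/-!
The smoothing matrix is `D⁻¹ A`, where `A` is the symmetric matrix of kernel values and `D` holds its
row sums. It has the characteristic polynomial of the symmetric matrix `D^(-1/2) A D^(-1/2)`, also
when some row sums vanish (`charpoly_rowNormalize`). So its spectrum is real and bounded above by `1`,
and it contains a negative number as soon as the quadratic form of `A` takes a negative value. If `K`
is the transform of a positive measure, that form is an integral of squared moduli, which gives the
first half.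

For the second half, disjoint blocks of a fixed number `m` of sample points are independent and
identically distributed. So it suffices that, for some `m`, a block has with positive probability
an indefinite kernel matrix (`tendsto_measure_exists_blockEvent`): some block among the first `n`
points then has one with probability tending to one, and a vector on which the form of a principal
submatrix is negative can be extended by zero.

Such blocks come from an integrable function `w` with negative integral. Weighting by the reciprocal of
the density on `C`, the mean of `w ((x - y) / h)` over two independent points is the integral over
`C × C`, that is `h ∫ |C ∩ (C - h u)| w(u) du`. Divided by `h`, this tends to `|C| ∫ w < 0` as
`h → 0`, by continuity of the measure of the overlap of a compact set with its translates. In a sum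
over all pairs of `m` points the diagonal has only `m` terms, so for large `m` the mean of the sum is
negative (`exists_pi_sum_neg_pos`).

Two choices of `w` are used. If `K > K 0` on a set of positive measure, then `w = -(K - K 0)⁺` yields
two points at a scaled distance where `K` exceeds `K 0`, hence an indefinite `2 × 2` submatrix. This
case cannot be skipped: an unbounded integrable `K` may have a positive Fourier transform. Otherwise
`K` is essentially bounded. If its Fourier transform were nonnegative, Gaussian regularization and
Fatou's lemma would make it integrable, and `K` would agree almost everywhere with the transform of a
finite measure by Fourier inversion (`exists_isTransformOfPosFiniteMeasure`). So the Fourier transform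
is negative at some `ξ`, and `w(u) = K(u) cos (2 π ξ u)` serves: by the addition formula for the
cosine, a negative pair sum makes the form negative at one of two vectors.
-/

/-! ### Normalizations of a nonnegative symmetric matrix -/

noncomputable section

/-- The row-normalized matrix `D⁻¹ A`, where `D` is the diagonal matrix of the row sums of `A`. -/
def rowNormalize {n : ℕ} (A : Matrix (Fin n) (Fin n) ℝ) : Matrix (Fin n) (Fin n) ℝ :=
  Matrix.of fun i j => A i j / ∑ k, A i k

/-- The symmetric normalization `D^(-1/2) A D^(-1/2)`, where `D` is the diagonal matrix of the row
sums of `A`; a vanishing row sum has inverse square root `0`. -/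
def symmNormalize {n : ℕ} (A : Matrix (Fin n) (Fin n) ℝ) : Matrix (Fin n) (Fin n) ℝ :=
  Matrix.of fun i j => (√(∑ k, A i k))⁻¹ * A i j * (√(∑ k, A j k))⁻¹

variable {n : ℕ} {A : Matrix (Fin n) (Fin n) ℝ}

/-- Both normalizations are products of the same two factors, `D^(-1/2)` and `D^(-1/2) A`, in the
two possible orders; hence no invertibility of `D` is needed. -/
lemma charpoly_rowNormalize (hA : ∀ i j, 0 ≤ A i j) :
    (rowNormalize A).charpoly = (symmNormalize A).charpoly := by
  have h1 : rowNormalize A = Matrix.diagonal (fun i => (√(∑ k, A i k))⁻¹) *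
      (Matrix.diagonal (fun i => (√(∑ k, A i k))⁻¹) * A) := by
    ext i j
    have hs : 0 ≤ ∑ k, A i k := Finset.sum_nonneg fun k _ => hA i k
    rw [Matrix.diagonal_mul, Matrix.diagonal_mul, ← mul_assoc, ← mul_inv, Real.mul_self_sqrt hs,
      rowNormalize, Matrix.of_apply, div_eq_inv_mul]
  have h2 : symmNormalize A = (Matrix.diagonal (fun i => (√(∑ k, A i k))⁻¹) * A) *
      Matrix.diagonal (fun i => (√(∑ k, A i k))⁻¹) := by
    ext i j
    rw [Matrix.mul_diagonal, Matrix.diagonal_mul, symmNormalize, Matrix.of_apply]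
  rw [h1, h2, Matrix.charpoly_mul_comm]

lemma isHermitian_symmNormalize (hsymm : ∀ i j, A i j = A j i) :
    (symmNormalize A).IsHermitian := by
  ext i j
  simp only [symmNormalize, Matrix.conjTranspose_apply, Matrix.of_apply, star_trivial]
  rw [hsymm j i]
  ring

lemma complexSpectrum_rowNormalize (hA : ∀ i j, 0 ≤ A i j) (hsymm : ∀ i j, A i j = A j i) :
    complexSpectrum (rowNormalize A) =
      Set.range fun i => ((isHermitian_symmNormalize hsymm).eigenvalues i : ℂ) := by
  ext z
  rw [complexSpectrum, Matrix.mem_spectrum_iff_isRoot_charpoly, Matrix.charpoly_map,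
    charpoly_rowNormalize hA, (isHermitian_symmNormalize hsymm).charpoly_eq]
  simp only [Polynomial.map_prod, Polynomial.map_sub, Polynomial.map_X, Polynomial.map_C,
    Polynomial.IsRoot, Polynomial.eval_prod, Polynomial.eval_sub, Polynomial.eval_X,
    Polynomial.eval_C, Finset.prod_eq_zero_iff, Finset.mem_univ, true_and, sub_eq_zero,
    Set.mem_range]
  exact exists_congr fun i => eq_comm

lemma dotProduct_symmNormalize_mulVec (v : Fin n → ℝ) :
    v ⬝ᵥ (symmNormalize A).mulVec v =
      ∑ i, ∑ j, A i j * (v i * (√(∑ k, A i k))⁻¹) * (v j * (√(∑ k, A j k))⁻¹) := by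
  simp only [dotProduct, Matrix.mulVec, symmNormalize, Matrix.of_apply, Finset.mul_sum]
  exact Finset.sum_congr rfl fun i _ => Finset.sum_congr rfl fun j _ => by ring

lemma posSemidef_symmNormalize (hsymm : ∀ i j, A i j = A j i)
    (hpos : ∀ w : Fin n → ℝ, 0 ≤ ∑ i, ∑ j, A i j * w i * w j) :
    (symmNormalize A).PosSemidef := by
  refine Matrix.PosSemidef.of_dotProduct_mulVec_nonneg (isHermitian_symmNormalize hsymm)
    fun v => ?_
  rw [star_trivial, dotProduct_symmNormalize_mulVec]
  exact hpos fun i => v i * (√(∑ k, A i k))⁻¹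

/-- The form of the symmetric normalization is at most that of the identity: by the inequality
`2 a b ≤ a² + b²` its value at `v` is at most the sum of those `v i ^ 2` for which the `i`th row sum
does not vanish. -/
lemma posSemidef_one_sub_symmNormalize (hA : ∀ i j, 0 ≤ A i j) (hsymm : ∀ i j, A i j = A j i) :
    (1 - symmNormalize A).PosSemidef := by
  refine Matrix.PosSemidef.of_dotProduct_mulVec_nonneg
    (Matrix.isHermitian_one.sub (isHermitian_symmNormalize hsymm)) fun v => ?_
  rw [star_trivial, Matrix.sub_mulVec, Matrix.one_mulVec, dotProduct_sub,
    dotProduct_symmNormalize_mulVec, sub_nonneg]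
  set u : Fin n → ℝ := fun i => v i * (√(∑ k, A i k))⁻¹ with hu
  have h1 : ∑ i, ∑ j, A i j * u i * u j ≤
      ∑ i, ∑ j, (A i j * u i ^ 2 + A i j * u j ^ 2) / 2 := by
    refine Finset.sum_le_sum fun i _ => Finset.sum_le_sum fun j _ => ?_
    nlinarith [mul_nonneg (hA i j) (sq_nonneg (u i - u j))]
  have h2 : ∑ i, ∑ j, A i j * u j ^ 2 = ∑ i, ∑ j, A i j * u i ^ 2 := by
    rw [Finset.sum_comm]
    exact Finset.sum_congr rfl fun i _ => Finset.sum_congr rfl fun j _ => by rw [hsymm]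
  have h3 : ∑ i, ∑ j, (A i j * u i ^ 2 + A i j * u j ^ 2) / 2 = ∑ i, ∑ j, A i j * u i ^ 2 := by
    simp only [← Finset.sum_div, Finset.sum_add_distrib, h2]
    ring
  refine h1.trans (h3.le.trans ?_)
  rw [dotProduct]
  refine Finset.sum_le_sum fun i _ => ?_
  rw [← Finset.sum_mul, hu]
  have hs : 0 ≤ ∑ k, A i k := Finset.sum_nonneg fun k _ => hA i k
  rcases hs.eq_or_lt with h0 | h0
  · rw [← h0, zero_mul]
    exact mul_self_nonneg _
  · rw [mul_pow, inv_pow, Real.sq_sqrt hs]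
    field_simp
    exact le_rfl

/-- A nonnegative symmetric matrix whose quadratic form is nonnegative has a row normalization with
spectrum in `[0, 1]`. -/
lemma complexSpectrum_rowNormalize_subset (hA : ∀ i j, 0 ≤ A i j) (hsymm : ∀ i j, A i j = A j i)
    (hpos : ∀ w : Fin n → ℝ, 0 ≤ ∑ i, ∑ j, A i j * w i * w j) :
    complexSpectrum (rowNormalize A) ⊆ (fun r : ℝ => (r : ℂ)) '' Set.Icc 0 1 := by
  rw [complexSpectrum_rowNormalize hA hsymm]
  rintro _ ⟨i, rfl⟩
  refine ⟨_, ⟨(posSemidef_symmNormalize hsymm hpos).eigenvalues_nonneg i, ?_⟩, rfl⟩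
  set hT := isHermitian_symmNormalize hsymm
  set v : Fin n → ℝ := (hT.eigenvectorBasis i).ofLp with hv
  have h1 : 0 ≤ v ⬝ᵥ (1 - symmNormalize A).mulVec v := by
    simpa using (posSemidef_one_sub_symmNormalize hA hsymm).dotProduct_mulVec_nonneg v
  have h2 : v ⬝ᵥ v = 1 := by
    have := hT.eigenvectorBasis.orthonormal.1 i
    have h4 := real_inner_self_eq_norm_sq (hT.eigenvectorBasis i)
    rw [this, EuclideanSpace.inner_eq_star_dotProduct] at h4
    simpa [hv] using h4
  rw [Matrix.sub_mulVec, Matrix.one_mulVec, hv, hT.mulVec_eigenvectorBasis, ← hv, dotProduct_sub,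
    dotProduct_smul, h2] at h1
  simpa using h1

/-- If the quadratic form of a nonnegative symmetric matrix takes a negative value, then the row
normalization has a negative eigenvalue. -/
lemma exists_isMaxOfSpectrum_one_sub_rowNormalize (hA : ∀ i j, 0 ≤ A i j)
    (hsymm : ∀ i j, A i j = A j i) {w : Fin n → ℝ} (hw : ∑ i, ∑ j, A i j * w i * w j < 0) :
    ∃ r : ℝ, 1 < r ∧ IsMaxOfSpectrum (1 - rowNormalize A) r := by
  set hT := isHermitian_symmNormalize hsymm with hT_def
  have hneg : ∃ i, hT.eigenvalues i < 0 := by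
    by_contra! h
    have hps := (hT.posSemidef_iff_eigenvalues_nonneg).2 h
    have h1 := hps.dotProduct_mulVec_nonneg fun i => √(∑ k, A i k) * w i
    rw [star_trivial, dotProduct_symmNormalize_mulVec] at h1
    refine absurd (h1.trans_eq ?_) hw.not_ge
    refine Finset.sum_congr rfl fun i _ => Finset.sum_congr rfl fun j _ => ?_
    -- a vanishing row sum forces the whole row, hence the entry, to vanish
    have key : ∀ i j, √(∑ k, A i k) = 0 → A i j = 0 := fun i j h0 => by
      rw [Real.sqrt_eq_zero (Finset.sum_nonneg fun k _ => hA i k),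
        Finset.sum_eq_zero_iff_of_nonneg fun k _ => hA i k] at h0
      exact h0 j (Finset.mem_univ j)
    by_cases hi : √(∑ k, A i k) = 0
    · simp [key i j hi]
    by_cases hj : √(∑ k, A j k) = 0
    · simp [hsymm i j, key j i hj]
    field_simp
  obtain ⟨i₁, hi₁⟩ := hneg
  obtain ⟨i₀, -, hi₀⟩ := Finset.exists_min_image Finset.univ hT.eigenvalues ⟨i₁, Finset.mem_univ _⟩
  have hspec : complexSpectrum (1 - rowNormalize A) =
      {z | (1 : ℂ) - z ∈ complexSpectrum (rowNormalize A)} := by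
    ext z
    have : (1 - rowNormalize A).map (algebraMap ℝ ℂ) =
        algebraMap ℂ _ 1 - (rowNormalize A).map (algebraMap ℝ ℂ) := by
      rw [Matrix.map_sub _ (map_sub _), Matrix.map_one _ (map_zero _) (map_one _), map_one]
    rw [complexSpectrum, this, ← spectrum.singleton_sub_eq]
    simp only [Set.singleton_sub, Set.mem_image, Set.mem_ofPred_eq, complexSpectrum]
    constructor
    · rintro ⟨y, hy, rfl⟩
      simpa using hy
    · exact fun h => ⟨_, h, by ring⟩
  refine ⟨1 - hT.eigenvalues i₀, ?_, ?_, ?_⟩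
  · linarith [hi₀ i₁ (Finset.mem_univ _)]
  · rw [hspec, Set.mem_ofPred_eq, complexSpectrum_rowNormalize hA hsymm]
    exact ⟨i₀, by simp⟩
  · intro z hz
    rw [hspec, Set.mem_ofPred_eq, complexSpectrum_rowNormalize hA hsymm] at hz
    obtain ⟨i, hi⟩ := hz
    refine ⟨1 - hT.eigenvalues i, ?_, by linarith [hi₀ i (Finset.mem_univ _)]⟩
    simp only at hi
    rw [Complex.ofReal_sub, Complex.ofReal_one, hT_def, hi]
    ring

lemma nwMatrix_eq_rowNormalize (K : ℝ → ℝ) (h : ℝ) (x : Fin n → ℝ) :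
    nwMatrix K h x = rowNormalize (Matrix.of fun i j => scaledKernel K h (x i - x j)) := rfl

lemma scaledKernel_nonneg {K : ℝ → ℝ} (hK : ∀ x, 0 ≤ K x) {h : ℝ} (hh : 0 < h) (t : ℝ) :
    0 ≤ scaledKernel K h t :=
  mul_nonneg (inv_nonneg.2 hh.le) (hK _)

lemma scaledKernel_sub_comm {K : ℝ → ℝ} (hK : ∀ x, K (-x) = K x) (h x y : ℝ) :
    scaledKernel K h (x - y) = scaledKernel K h (y - x) := by
  rw [scaledKernel, scaledKernel, ← hK, ← neg_div, neg_sub]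

lemma sum_scaledKernel (K : ℝ → ℝ) (h : ℝ) (x w : Fin n → ℝ) :
    ∑ i, ∑ j, (Matrix.of fun i j => scaledKernel K h (x i - x j)) i j * w i * w j =
      h⁻¹ * ∑ i, ∑ j, K ((x i - x j) / h) * w i * w j := by
  simp only [Finset.mul_sum, Matrix.of_apply, scaledKernel, mul_assoc]

lemma exists_isMaxOfSpectrum_one_sub_nwMatrix {K : ℝ → ℝ} (hK : ∀ x, 0 ≤ K x)
    (heven : ∀ x, K (-x) = K x) {h : ℝ} (hh : 0 < h) {x w : Fin n → ℝ}
    (hw : ∑ i, ∑ j, K ((x i - x j) / h) * w i * w j < 0) :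
    ∃ r : ℝ, 1 < r ∧ IsMaxOfSpectrum (1 - nwMatrix K h x) r := by
  rw [nwMatrix_eq_rowNormalize]
  refine exists_isMaxOfSpectrum_one_sub_rowNormalize (w := w)
    (fun i j => scaledKernel_nonneg hK hh _) (fun i j => scaledKernel_sub_comm heven h _ _) ?_
  rw [sum_scaledKernel]
  exact mul_neg_of_pos_of_neg (inv_pos.2 hh) hw

end

/-! ### Transforms of positive measures -/

noncomputable section

lemma IsTransformOfPosFiniteMeasure.even {K : ℝ → ℝ} (hK : IsTransformOfPosFiniteMeasure K)
    (x : ℝ) : K (-x) = K x := by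
  obtain ⟨ν, _, hν⟩ := hK
  have h1 := hν (-x)
  have h2 := congrArg (starRingEnd ℂ) (hν x)
  rw [Complex.conj_ofReal, ← integral_conj] at h2
  have h3 : (K (-x) : ℂ) = K x := by
    rw [h1, h2]
    refine integral_congr_ae (ae_of_all _ fun t => ?_)
    simp only [← Complex.exp_conj]
    simp [map_ofNat]
  exact_mod_cast h3

/-- The easy half of Bochner's theorem: the quadratic form is the integral of
`|∑ᵢ wᵢ exp (-2 π i yᵢ t)|²` against the measure. -/
lemma IsTransformOfPosFiniteMeasure.sum_nonneg {K : ℝ → ℝ} (hK : IsTransformOfPosFiniteMeasure K)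
    {n : ℕ} (y w : Fin n → ℝ) : 0 ≤ ∑ i, ∑ j, K (y i - y j) * w i * w j := by
  obtain ⟨ν, _, hν⟩ := hK
  set e : Fin n → ℝ → ℂ := fun i t => Complex.exp (-2 * Real.pi * Complex.I * y i * t) with he
  have hint : ∀ x : ℝ, Integrable
      (fun t : ℝ => Complex.exp (-2 * Real.pi * Complex.I * x * t)) ν := fun x => by
    refine Integrable.of_bound (by fun_prop) 1 (ae_of_all _ fun t => ?_)
    rw [Complex.norm_exp]
    simp
  have h1 : ((∑ i, ∑ j, K (y i - y j) * w i * w j : ℝ) : ℂ) =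
      ∫ t, ((Complex.normSq (∑ i, w i * e i t) : ℝ) : ℂ) ∂ν := by
    have h2 : ∀ t, ((Complex.normSq (∑ i, w i * e i t) : ℝ) : ℂ) = ∑ i, ∑ j,
        Complex.exp (-2 * Real.pi * Complex.I * ((y i - y j : ℝ) : ℂ) * t) * w i * w j := by
      intro t
      rw [Complex.normSq_eq_conj_mul_self, mul_comm, map_sum, Finset.sum_mul_sum]
      refine Finset.sum_congr rfl fun i _ => Finset.sum_congr rfl fun j _ => ?_
      have : Complex.exp (-2 * Real.pi * Complex.I * ((y i - y j : ℝ) : ℂ) * t) =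
          e i t * starRingEnd ℂ (e j t) := by
        simp only [he]
        rw [← Complex.exp_conj, ← Complex.exp_add]
        congr 1
        simp [map_ofNat]
        ring
      rw [this, map_mul, Complex.conj_ofReal]
      ring
    simp only [h2]
    rw [integral_finsetSum _ fun i _ => integrable_finsetSum _ fun j _ =>
      ((hint _).mul_const _).mul_const _, Complex.ofReal_sum]
    refine Finset.sum_congr rfl fun i _ => ?_
    rw [integral_finsetSum _ fun j _ => ((hint _).mul_const _).mul_const _, Complex.ofReal_sum]
    refine Finset.sum_congr rfl fun j _ => ?_
    rw [integral_mul_const, integral_mul_const, ← hν, Complex.ofReal_mul, Complex.ofReal_mul]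
  rw [integral_complex_ofReal] at h1
  rw [Complex.ofReal_injective h1]
  exact integral_nonneg fun t => Complex.normSq_nonneg _

lemma complexSpectrum_nwMatrix_subset {K : ℝ → ℝ} (hK : ∀ x, 0 ≤ K x)
    (hKt : IsTransformOfPosFiniteMeasure K) {n : ℕ} (x : Fin n → ℝ) {h : ℝ} (hh : 0 < h) :
    complexSpectrum (nwMatrix K h x) ⊆ (fun r : ℝ => (r : ℂ)) '' Set.Icc 0 1 := by
  rw [nwMatrix_eq_rowNormalize]
  refine complexSpectrum_rowNormalize_subset (fun i j => scaledKernel_nonneg hK hh _)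
    (fun i j => scaledKernel_sub_comm hKt.even h _ _) fun w => ?_
  rw [sum_scaledKernel]
  simp only [sub_div]
  exact mul_nonneg (inv_nonneg.2 hh.le) (hKt.sum_nonneg (fun i => x i / h) w)

end

/-! ### Fourier transforms of even functions and inversion -/

noncomputable section

open scoped FourierTransform ContDiff

/-- The cosine transform of a function on the line; for an even function this is its Fourier
transform. -/
def cosTransform (g : ℝ → ℝ) (ξ : ℝ) : ℝ := ∫ x, g x * Real.cos (2 * Real.pi * ξ * x)

lemma cosTransform_neg (g : ℝ → ℝ) (ξ : ℝ) : cosTransform g (-ξ) = cosTransform g ξ := by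
  refine integral_congr_ae (ae_of_all _ fun x => ?_)
  simp only
  rw [← Real.cos_neg]
  ring_nf

lemma fourier_ofReal_of_even {g : ℝ → ℝ} (hg : Integrable g) (heven : ∀ x, g (-x) = g x) (ξ : ℝ) :
    𝓕 (fun x => (g x : ℂ)) ξ = (cosTransform g ξ : ℂ) := by
  have h1 : Integrable fun x => g x * Real.cos (2 * Real.pi * ξ * x) :=
    hg.mul_bdd (c := 1) (by fun_prop) (ae_of_all _ fun x => Real.abs_cos_le_one _)
  have h2 : Integrable fun x => g x * Real.sin (2 * Real.pi * ξ * x) :=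
    hg.mul_bdd (c := 1) (by fun_prop) (ae_of_all _ fun x => Real.abs_sin_le_one _)
  have h3 : ∫ x, g x * Real.sin (2 * Real.pi * ξ * x) = 0 := by
    have h4 := integral_neg_eq_self (fun x => g x * Real.sin (2 * Real.pi * ξ * x)) volume
    have h5 : ∀ x, g (-x) * Real.sin (2 * Real.pi * ξ * -x) =
        -(g x * Real.sin (2 * Real.pi * ξ * x)) := fun x => by
      rw [heven, mul_neg, Real.sin_neg, mul_neg]
    simp only [h5, integral_neg] at h4
    linarith
  have h6 : ∀ x : ℝ, Complex.exp (↑(-2 * Real.pi * x * ξ) * Complex.I) • (g x : ℂ) =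
      ((g x * Real.cos (2 * Real.pi * ξ * x) : ℝ) : ℂ) -
        Complex.I * ((g x * Real.sin (2 * Real.pi * ξ * x) : ℝ) : ℂ) := fun x => by
    rw [show -2 * Real.pi * x * ξ = -(2 * Real.pi * ξ * x) by ring, Complex.exp_mul_I,
      ← Complex.ofReal_cos, ← Complex.ofReal_sin, Real.cos_neg, Real.sin_neg, smul_eq_mul]
    push_cast
    ring
  rw [Real.fourier_real_eq_integral_exp_smul]
  simp only [h6]
  rw [integral_sub h1.ofReal (h2.ofReal.const_mul _), integral_const_mul, integral_complex_ofReal,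
    integral_complex_ofReal, h3, cosTransform]
  simp

lemma integral_fourier_mul_eq_flip {f g : ℝ → ℂ} (hf : Integrable f) (hg : Integrable g) :
    ∫ ξ, 𝓕 f ξ * g ξ = ∫ x, f x * 𝓕 g x := by
  simpa using! VectorFourier.integral_fourierIntegral_smul_eq_flip (L := innerₗ ℝ)
    Real.continuous_fourierChar continuous_inner hf hg

lemma integral_fourierInv_mul_eq_flip {f g : ℝ → ℂ} (hf : Integrable f) (hg : Integrable g) :
    ∫ ξ, 𝓕⁻ f ξ * g ξ = ∫ x, f x * 𝓕⁻ g x := by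
  have h := integral_fourier_mul_eq_flip hf hg.comp_neg
  rw [← integral_neg_eq_self] at h
  simp only [Real.fourierInv_eq_fourier_neg]
  simp only [neg_neg] at h
  rw [h]
  refine integral_congr_ae (ae_of_all _ fun x => ?_)
  simp only
  rw [← Real.fourierInv_eq_fourier_neg, Real.fourierInv_eq_fourier_comp_neg]

lemma integrable_fourierInv_of_integrable_fourier {f : ℝ → ℂ} (h : Integrable (𝓕 f)) :
    Integrable (𝓕⁻ f) := by
  have : 𝓕⁻ f = fun x => 𝓕 f (-x) := funext fun x => Real.fourierInv_eq_fourier_neg f x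
  rw [this]
  exact h.comp_neg

/-- Fourier inversion almost everywhere, for an integrable function which need not be continuous:
both sides have the same integral against every smooth compactly supported function. -/
lemma fourierInv_fourier_ae_eq {f : ℝ → ℂ} (hf : Integrable f) (h'f : Integrable (𝓕 f)) :
    𝓕⁻ (𝓕 f) =ᵐ[volume] f := by
  have hcont : Continuous (𝓕⁻ (𝓕 f)) := by
    have h1 : Continuous (𝓕 (𝓕 f)) :=
      VectorFourier.fourierIntegral_continuous Real.continuous_fourierChar
        (by exact continuous_inner) h'f
    have : 𝓕⁻ (𝓕 f) = fun x => 𝓕 (𝓕 f) (-x) :=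
      funext fun x => Real.fourierInv_eq_fourier_neg _ x
    rw [this]
    exact h1.comp continuous_neg
  refine ae_eq_of_integral_contDiff_smul_eq hcont.locallyIntegrable hf.locallyIntegrable ?_
  intro g hg hgs
  set G : ℝ → ℂ := fun x => (g x : ℂ) with hG
  have hGd : ContDiff ℝ ∞ G := Complex.ofRealCLM.contDiff.comp hg
  have hGs : HasCompactSupport G := hgs.comp_left Complex.ofReal_zero
  have hGc : Continuous G := hGd.continuous
  have hGi : Integrable G := hGc.integrable_of_hasCompactSupport hGs
  have hFG : Integrable (𝓕 G) := by
    have := (𝓕 (hGs.toSchwartzMap hGd)).integrable (μ := volume)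
    rw [SchwartzMap.fourier_coe] at this
    exact this
  have hFiG := integrable_fourierInv_of_integrable_fourier hFG
  -- write the test function as a Fourier transform, so that both transforms can be moved onto it
  have h1 : 𝓕 (𝓕⁻ G) = G := hGc.fourier_fourierInv_eq hGi hFG
  have h2 := integral_fourier_mul_eq_flip hFiG hf
  have h3 := integral_fourierInv_mul_eq_flip hGi h'f
  rw [h1] at h2
  simp only [Complex.real_smul]
  exact h3.symm.trans h2.symm

/-- Gaussian regularization of the integral of the cosine transform. -/
lemma integral_cosTransform_mul_gaussian_le {K : ℝ → ℝ} (hK : Integrable K)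
    (heven : ∀ x, K (-x) = K x) {M : ℝ} (hM : ∀ᵐ x, K x ≤ M) {b : ℝ} (hb : 0 < b) :
    ∫ ξ, cosTransform K ξ * Real.exp (-(Real.pi * b) * ξ ^ 2) ≤ M := by
  have hpb : 0 < Real.pi * b := mul_pos Real.pi_pos hb
  have hpb' : 0 < Real.pi / b := div_pos Real.pi_pos hb
  have hg : Integrable fun x : ℝ => Real.exp (-(Real.pi * b) * x ^ 2) :=
    integrable_exp_neg_mul_sq hpb
  have hF : ∀ x : ℝ, 𝓕 (fun ξ : ℝ => ((Real.exp (-(Real.pi * b) * ξ ^ 2) : ℝ) : ℂ)) x =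
      (((√b)⁻¹ * Real.exp (-(Real.pi / b) * x ^ 2) : ℝ) : ℂ) := fun x => by
    have h2 := congrFun (fourier_gaussian_pi (b := (b : ℂ)) (by simpa using hb)) x
    have h3 : ((b : ℂ) ^ (1 / 2 : ℂ)) = ((√b : ℝ) : ℂ) := by
      rw [Real.sqrt_eq_rpow, Complex.ofReal_cpow hb.le]
      simp
    rw [h3] at h2
    push_cast
    simpa [neg_div, one_div, neg_mul] using h2
  have h1 := integral_fourier_mul_eq_flip hK.ofReal hg.ofReal
  simp only [Complex.coe_algebraMap, hF, fourier_ofReal_of_even hK heven, ← Complex.ofReal_mul] at h1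
  rw [integral_complex_ofReal, integral_complex_ofReal] at h1
  have hg' : Integrable fun x : ℝ => (√b)⁻¹ * Real.exp (-(Real.pi / b) * x ^ 2) :=
    (integrable_exp_neg_mul_sq hpb').const_mul _
  have hg1 : ∫ x : ℝ, (√b)⁻¹ * Real.exp (-(Real.pi / b) * x ^ 2) = 1 := by
    rw [integral_const_mul, integral_gaussian]
    have : Real.pi / (Real.pi / b) = b := by field_simp
    rw [this]
    exact inv_mul_cancel₀ (Real.sqrt_pos.2 hb).ne'
  rw [Complex.ofReal_injective h1]
  calc ∫ x, K x * ((√b)⁻¹ * Real.exp (-(Real.pi / b) * x ^ 2))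
      ≤ ∫ x : ℝ, M * ((√b)⁻¹ * Real.exp (-(Real.pi / b) * x ^ 2)) := by
        refine integral_mono_ae ?_ (hg'.const_mul M) ?_
        · refine hK.mul_bdd (c := (√b)⁻¹) (by fun_prop) (ae_of_all _ fun x => ?_)
          rw [Real.norm_of_nonneg (by positivity)]
          refine mul_le_of_le_one_right (by positivity) (Real.exp_le_one_iff.2 ?_)
          nlinarith [sq_nonneg x]
        · filter_upwards [hM] with x hx
          exact mul_le_mul_of_nonneg_right hx (by positivity)
    _ = M := by rw [integral_const_mul, hg1, mul_one]

lemma continuous_cosTransform {g : ℝ → ℝ} (hg : Integrable g) : Continuous (cosTransform g) := by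
  refine continuous_of_dominated (bound := fun x => ‖g x‖) (fun ξ => ?_) (fun ξ => ?_) hg.norm ?_
  · exact hg.aestronglyMeasurable.mul (by fun_prop)
  · refine ae_of_all _ fun x => ?_
    rw [norm_mul]
    exact mul_le_of_le_one_right (norm_nonneg _) (Real.abs_cos_le_one _)
  · exact ae_of_all _ fun x => by fun_prop

/-- An even integrable function which is essentially bounded above and has a nonnegative Fourier
transform has an integrable Fourier transform. -/
lemma integrable_cosTransform {K : ℝ → ℝ} (hK : Integrable K) (heven : ∀ x, K (-x) = K x) {M : ℝ}
    (hM : ∀ᵐ x, K x ≤ M) (hpos : ∀ ξ, 0 ≤ cosTransform K ξ) : Integrable (cosTransform K) := by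
  have hc := continuous_cosTransform hK
  refine ⟨hc.aestronglyMeasurable, ?_⟩
  rw [hasFiniteIntegral_iff_ofReal (ae_of_all _ hpos)]
  set b : ℕ → ℝ := fun n => 1 / ((n : ℝ) + 1) with hb
  have hb0 : ∀ n, 0 < b n := fun n => by positivity
  have hlim : ∀ ξ : ℝ, Tendsto (fun n => ENNReal.ofReal
      (cosTransform K ξ * Real.exp (-(Real.pi * b n) * ξ ^ 2))) atTop
      (𝓝 (ENNReal.ofReal (cosTransform K ξ))) := fun ξ => by
    refine ENNReal.tendsto_ofReal ?_
    have h1 : Tendsto b atTop (𝓝 0) := tendsto_one_div_add_atTop_nhds_zero_nat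
    have h2 : Continuous fun s : ℝ => cosTransform K ξ * Real.exp (-(Real.pi * s) * ξ ^ 2) := by
      fun_prop
    simpa [Function.comp_def] using (h2.tendsto 0).comp h1
  refine lt_of_le_of_lt ?_ (ENNReal.ofReal_lt_top (r := M))
  calc ∫⁻ ξ, ENNReal.ofReal (cosTransform K ξ)
      = ∫⁻ ξ, liminf (fun n => ENNReal.ofReal
          (cosTransform K ξ * Real.exp (-(Real.pi * b n) * ξ ^ 2))) atTop :=
        lintegral_congr fun ξ => (hlim ξ).liminf_eq.symm
    _ ≤ liminf (fun n => ∫⁻ ξ, ENNReal.ofReal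
          (cosTransform K ξ * Real.exp (-(Real.pi * b n) * ξ ^ 2))) atTop :=
        lintegral_liminf_le fun n => by fun_prop
    _ ≤ liminf (fun _ : ℕ => ENNReal.ofReal M) atTop := by
        refine liminf_le_liminf (Eventually.of_forall fun n => ?_)
        rw [← ofReal_integral_eq_lintegral_ofReal]
        · exact ENNReal.ofReal_le_ofReal
            (integral_cosTransform_mul_gaussian_le hK heven hM (hb0 n))
        · refine (integrable_exp_neg_mul_sq (mul_pos Real.pi_pos (hb0 n))).bdd_mul
            (c := ∫ x, ‖K x‖) hc.aestronglyMeasurable (ae_of_all _ fun ξ => ?_)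
          refine (norm_integral_le_integral_norm _).trans ?_
          refine integral_mono_of_nonneg (ae_of_all _ fun x => norm_nonneg _) hK.norm
            (ae_of_all _ fun x => ?_)
          simp only [norm_mul]
          exact mul_le_of_le_one_right (norm_nonneg _) (Real.abs_cos_le_one _)
        · exact ae_of_all _ fun ξ => mul_nonneg (hpos ξ) (Real.exp_nonneg _)
    _ = ENNReal.ofReal M := liminf_const _

/-- The part of Bochner's theorem that is needed: an even integrable function which is essentially
bounded above and has a nonnegative Fourier transform agrees almost everywhere with the transform of
a finite positive measure, whose density is that Fourier transform. -/
lemma exists_isTransformOfPosFiniteMeasure {K : ℝ → ℝ} (hK : Integrable K)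
    (heven : ∀ x, K (-x) = K x) {M : ℝ} (hM : ∀ᵐ x, K x ≤ M) (hpos : ∀ ξ, 0 ≤ cosTransform K ξ) :
    ∃ K' : ℝ → ℝ, K' =ᵐ[volume] K ∧ IsTransformOfPosFiniteMeasure K' := by
  have hc := integrable_cosTransform hK heven hM hpos
  have hFK : 𝓕 (fun x => (K x : ℂ)) = fun ξ => (cosTransform K ξ : ℂ) :=
    funext (fourier_ofReal_of_even hK heven)
  have hFFK : ∀ x, 𝓕 (fun ξ => (cosTransform K ξ : ℂ)) x = (cosTransform (cosTransform K) x : ℂ) :=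
    fourier_ofReal_of_even hc (cosTransform_neg K)
  refine ⟨cosTransform (cosTransform K), ?_,
    volume.withDensity fun ξ => ENNReal.ofReal (cosTransform K ξ), ?_, fun x => ?_⟩
  · have h1 := fourierInv_fourier_ae_eq (f := fun x => (K x : ℂ)) hK.ofReal
      (by rw [hFK]; exact hc.ofReal)
    filter_upwards [h1] with x hx
    rw [hFK, Real.fourierInv_eq_fourier_neg, hFFK, cosTransform_neg] at hx
    exact_mod_cast hx
  · refine isFiniteMeasure_withDensity_ofReal hc.2
  · rw [← hFFK, Real.fourier_real_eq_integral_exp_smul,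
      integral_withDensity_eq_integral_toReal_smul (by
        exact (continuous_cosTransform hK).measurable.ennreal_ofReal)
        (ae_of_all _ fun _ => ENNReal.ofReal_lt_top)]
    refine integral_congr_ae (ae_of_all _ fun ξ => ?_)
    simp only
    rw [ENNReal.toReal_ofReal (hpos ξ), Complex.real_smul, smul_eq_mul, mul_comm]
    congr 2
    push_cast
    ring

end

/-! ### Overlaps of a compact set with its translates -/

noncomputable section

open scoped Pointwise

/-- The Lebesgue measure of the set of those `y` for which `y` and `t + y` both lie in `C`. -/
def overlap (C : Set ℝ) (t : ℝ) : ℝ := volume.real ((t + ·) ⁻¹' C ∩ C)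

lemma overlap_nonneg (C : Set ℝ) (t : ℝ) : 0 ≤ overlap C t := measureReal_nonneg

lemma overlap_le {C : Set ℝ} (hC : IsCompact C) (t : ℝ) : overlap C t ≤ volume.real C :=
  measureReal_mono Set.inter_subset_right hC.measure_lt_top.ne

lemma tendsto_overlap {C : Set ℝ} (hC : IsCompact C) :
    Tendsto (overlap C) (𝓝 0) (𝓝 (volume.real C)) := by
  have h1 := tendsto_measure_vadd_sdiff_isCompact_isClosed (μ := (volume : Measure ℝ)) hC
    hC.isClosed
  have h2 : Tendsto (fun t : ℝ => (volume ((-t +ᵥ C) \ C)).toReal) (𝓝 0) (𝓝 0) := by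
    have h3 : Tendsto (fun t : ℝ => -t) (𝓝 0) (𝓝 0) := by
      simpa using continuous_neg.tendsto (0 : ℝ)
    simpa [Function.comp_def] using
      (ENNReal.tendsto_toReal ENNReal.zero_ne_top).comp (h1.comp h3)
  have h4 : overlap C = fun t : ℝ => volume.real C - (volume ((-t +ᵥ C) \ C)).toReal := by
    ext t
    have h5 : (t + ·) ⁻¹' C = -t +ᵥ C := Set.preimage_vadd t C
    have h6 : volume.real (-t +ᵥ C) = volume.real C := by
      rw [measureReal_def, measure_vadd, measureReal_def]
    have h7 := measureReal_inter_add_sdiff (μ := volume) (s := -t +ᵥ C) hC.measurableSet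
      (by rw [measure_vadd]; exact hC.measure_lt_top.ne)
    rw [overlap, h5, ← h6, ← h7, measureReal_def volume ((-t +ᵥ C) \ C)]
    ring
  rw [h4]
  simpa using tendsto_const_nhds.sub h2

lemma measurable_overlap {C : Set ℝ} (hC : MeasurableSet C) : Measurable (overlap C) := by
  have h1 : MeasurableSet {p : ℝ × ℝ | p.1 + p.2 ∈ C ∧ p.2 ∈ C} :=
    (measurable_add hC).inter (measurable_snd hC)
  exact (measurable_measure_prodMk_left h1).ennreal_toReal

lemma integrable_indicator_mul {C : Set ℝ} (hC : IsCompact C) {w : ℝ → ℝ} (hw : Integrable w)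
    {h : ℝ} (hh : 0 < h) :
    Integrable (fun z : ℝ × ℝ => C.indicator 1 z.1 * C.indicator 1 z.2 * w ((z.1 - z.2) / h))
      (volume.prod volume) := by
  have h0 : Integrable (C.indicator (1 : ℝ → ℝ)) :=
    (integrable_indicator_iff hC.measurableSet).2 (integrableOn_const hC.measure_lt_top.ne)
  have h1 : Integrable (fun p : ℝ × ℝ => w (p.1 / h) * C.indicator 1 p.2)
      (volume.prod volume) :=
    (hw.comp_div hh.ne').mul_prod h0
  have h2 := (measurePreserving_sub_prod (volume : Measure ℝ) volume).integrable_comp_of_integrable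
    h1
  refine (h2.bdd_mul (f := fun z : ℝ × ℝ => C.indicator (1 : ℝ → ℝ) z.1) (c := 1) ?_ ?_).congr ?_
  · exact ((measurable_one.indicator hC.measurableSet).comp measurable_fst).aestronglyMeasurable
  · refine ae_of_all _ fun z => ?_
    by_cases hz : z.1 ∈ C <;> simp [hz]
  · refine ae_of_all _ fun z => ?_
    simp only [Function.comp_apply]
    ring

lemma integral_indicator_mul {C : Set ℝ} (hC : IsCompact C) {w : ℝ → ℝ} (hw : Integrable w)
    {h : ℝ} (hh : 0 < h) :
    ∫ z : ℝ × ℝ, C.indicator 1 z.1 * C.indicator 1 z.2 * w ((z.1 - z.2) / h)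
      ∂(volume.prod volume) = h * ∫ u, overlap C (h * u) * w u := by
  have hmp := measurePreserving_add_prod (volume : Measure ℝ) volume
  have h1 : Integrable (fun p : ℝ × ℝ => C.indicator (1 : ℝ → ℝ) (p.1 + p.2) * C.indicator 1 p.2 *
      w (p.1 / h)) (volume.prod volume) := by
    have := hmp.integrable_comp_of_integrable (integrable_indicator_mul hC hw hh)
    simpa [Function.comp_def] using this
  have h2 : ∀ s : ℝ, ∫ y, C.indicator (1 : ℝ → ℝ) (s + y) * C.indicator 1 y = overlap C s := by
    intro s
    have h3 : (fun y => C.indicator (1 : ℝ → ℝ) (s + y) * C.indicator 1 y) =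
        ((s + ·) ⁻¹' C ∩ C).indicator 1 := by
      ext y
      by_cases h4 : s + y ∈ C <;> by_cases h5 : y ∈ C <;> simp [h4, h5]
    rw [h3, integral_indicator_one ((measurable_const_add s hC.measurableSet).inter
      hC.measurableSet), overlap]
  have h6 := integral_map (μ := (volume : Measure ℝ).prod volume) hmp.aemeasurable
    (f := fun z : ℝ × ℝ => C.indicator 1 z.1 * C.indicator 1 z.2 * w ((z.1 - z.2) / h))
    (by rw [hmp.map_eq]; exact (integrable_indicator_mul hC hw hh).aestronglyMeasurable)
  rw [hmp.map_eq] at h6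
  rw [h6]
  simp only [add_sub_cancel_right]
  rw [integral_prod _ h1]
  simp only [integral_mul_const, h2]
  have h7 := Measure.integral_comp_mul_left (fun s => overlap C s * w (s / h)) h
  rw [abs_of_pos (inv_pos.2 hh), smul_eq_mul] at h7
  have h8 : ∀ u, overlap C (h * u) * w (h * u / h) = overlap C (h * u) * w u := fun u => by
    rw [mul_div_cancel_left₀ _ hh.ne']
  simp only [h8] at h7
  rw [h7, mul_inv_cancel_left₀ hh.ne']

/-- At small bandwidths the set `C` looks like the whole line: if `w` has negative integral then so
has `w ((x - y) / h)` over `C × C`. -/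
lemma exists_integral_indicator_mul_neg {C : Set ℝ} (hC : IsCompact C) (hCpos : 0 < volume C)
    {w : ℝ → ℝ} (hw : Integrable w) (hneg : ∫ u, w u < 0) :
    ∃ h₀ : ℝ, 0 < h₀ ∧ ∀ h : ℝ, 0 < h → h < h₀ →
      ∫ z : ℝ × ℝ, C.indicator 1 z.1 * C.indicator 1 z.2 * w ((z.1 - z.2) / h)
        ∂(volume.prod volume) < 0 := by
  have hv : 0 < volume.real C := ENNReal.toReal_pos hCpos.ne' hC.measure_lt_top.ne
  have hlim : Tendsto (fun h : ℝ => ∫ u, overlap C (h * u) * w u) (𝓝 0)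
      (𝓝 (∫ u, volume.real C * w u)) := by
    refine tendsto_integral_filter_of_dominated_convergence
      (fun u => volume.real C * ‖w u‖) ?_ ?_ (hw.norm.const_mul _) ?_
    · refine Eventually.of_forall fun h => ?_
      exact ((measurable_overlap hC.measurableSet).comp
        (measurable_const_mul h)).aestronglyMeasurable.mul hw.aestronglyMeasurable
    · refine Eventually.of_forall fun h => ae_of_all _ fun u => ?_
      rw [norm_mul, Real.norm_of_nonneg (overlap_nonneg _ _)]
      exact mul_le_mul_of_nonneg_right (overlap_le hC _) (norm_nonneg _)
    · refine ae_of_all _ fun u => Tendsto.mul_const _ ((tendsto_overlap hC).comp ?_)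
      have : Continuous fun h : ℝ => h * u := by fun_prop
      simpa using this.tendsto 0
  rw [integral_const_mul] at hlim
  obtain ⟨h₀, hh₀, H⟩ := Metric.eventually_nhds_iff.1
    (hlim.eventually_lt_const (mul_neg_of_pos_of_neg hv hneg))
  refine ⟨h₀, hh₀, fun h hpos hlt => ?_⟩
  rw [integral_indicator_mul hC hw hpos]
  refine mul_neg_of_pos_of_neg hpos (H ?_)
  rwa [Real.dist_eq, sub_zero, abs_of_pos hpos]

end

/-! ### Indefinite kernel matrices with positive probability -/

noncomputable section

/-- If a function of two independent samples has negative mean, then with positive probability its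
sum over all pairs from a large sample is negative: the diagonal contributes only linearly many
terms. -/
lemma exists_pi_sum_neg_pos (μ : Measure ℝ) [IsProbabilityMeasure μ] {G : ℝ × ℝ → ℝ}
    (hG : Integrable G (μ.prod μ)) (hGd : Integrable (fun x => G (x, x)) μ)
    (hneg : ∫ z, G z ∂(μ.prod μ) < 0) :
    ∃ m : ℕ, 0 < Measure.pi (fun _ : Fin m => μ) {x | ∑ i, ∑ j, G (x i, x j) < 0} := by
  set J := ∫ z, G z ∂(μ.prod μ) with hJ
  set E := ∫ x, G (x, x) ∂μ with hE
  -- the mean over `N + 1` points is `(N + 1) * (E + N * J)`, negative once `N * -J > E`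
  obtain ⟨N, hN⟩ := exists_nat_gt (E / -J)
  rw [div_lt_iff₀ (neg_pos.2 hneg)] at hN
  refine ⟨N + 1, ?_⟩
  set P := Measure.pi (fun _ : Fin (N + 1) => μ) with hP
  have hpair : ∀ i j : Fin (N + 1), i ≠ j →
      MeasurePreserving (fun x : Fin (N + 1) → ℝ => (x i, x j)) P (μ.prod μ) := by
    intro i j hij
    refine ⟨by fun_prop, ?_⟩
    have h1 : iIndepFun (fun (i : Fin (N + 1)) (x : Fin (N + 1) → ℝ) => x i) P :=
      iIndepFun_pi (X := fun _ => id) fun _ => aemeasurable_id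
    have h2 := (indepFun_iff_map_prod_eq_prod_map_map (measurable_pi_apply i).aemeasurable
      (measurable_pi_apply j).aemeasurable).1 (h1.indepFun hij)
    rw [h2, (measurePreserving_eval (fun _ : Fin (N + 1) => μ) i).map_eq,
      (measurePreserving_eval (fun _ : Fin (N + 1) => μ) j).map_eq]
  have hterm : ∀ i j : Fin (N + 1), Integrable (fun x : Fin (N + 1) → ℝ => G (x i, x j)) P ∧
      ∫ x : Fin (N + 1) → ℝ, G (x i, x j) ∂P = if i = j then E else J := by
    intro i j
    split_ifs with hij
    · subst hij
      have h1 := measurePreserving_eval (fun _ : Fin (N + 1) => μ) i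
      refine ⟨h1.integrable_comp_of_integrable hGd, ?_⟩
      have h2 := integral_map (μ := P) h1.aemeasurable (f := fun x => G (x, x))
        (by rw [h1.map_eq]; exact hGd.aestronglyMeasurable)
      rw [h1.map_eq] at h2
      exact h2.symm
    · have h1 := hpair i j hij
      refine ⟨h1.integrable_comp_of_integrable hG, ?_⟩
      have h2 := integral_map (μ := P) h1.aemeasurable (f := G)
        (by rw [h1.map_eq]; exact hG.aestronglyMeasurable)
      rw [h1.map_eq] at h2
      exact h2.symm
  have hsum : ∫ x : Fin (N + 1) → ℝ, ∑ i, ∑ j, G (x i, x j) ∂P = (N + 1) * (E + N * J) := by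
    rw [integral_finsetSum _ fun i _ => integrable_finsetSum _ fun j _ => (hterm i j).1]
    have h1 : ∀ i : Fin (N + 1), ∫ x : Fin (N + 1) → ℝ, ∑ j, G (x i, x j) ∂P = E + N * J := by
      intro i
      rw [integral_finsetSum _ fun j _ => (hterm i j).1]
      simp only [(hterm i _).2]
      have h2 : ∀ j : Fin (N + 1), (if i = j then E else J) = (if i = j then E - J else 0) + J :=
        fun j => by split_ifs <;> ring
      simp only [h2, Finset.sum_add_distrib, Finset.sum_ite_eq, Finset.mem_univ, if_true,
        Finset.sum_const, Finset.card_univ, Fintype.card_fin, nsmul_eq_mul]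
      push_cast
      ring
    simp only [h1, Finset.sum_const, Finset.card_univ, Fintype.card_fin, nsmul_eq_mul]
    push_cast
    ring
  by_contra h0
  have h1 : ∀ᵐ x ∂P, 0 ≤ ∑ i, ∑ j, G (x i, x j) := by
    rw [ae_iff]
    simpa using h0
  have h2 := integral_nonneg_of_ae h1
  rw [hsum] at h2
  have h3 : E + N * J < 0 := by linarith
  have h4 : (0 : ℝ) < N + 1 := by positivity
  nlinarith

section Density

variable {f : ℝ → ℝ} {C : Set ℝ} {c : ℝ}

lemma isProbabilityMeasure_withDensity (hf : IsProbDensity f) :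
    IsProbabilityMeasure (volume.withDensity fun x => ENNReal.ofReal (f x)) :=
  ⟨by rw [withDensity_apply _ MeasurableSet.univ, setLIntegral_univ, hf.lintegral_eq_one]⟩

/-- The weight `1 / f` on `C`, which turns the law with density `f` into Lebesgue measure on `C`. -/
def densityWeight (f : ℝ → ℝ) (C : Set ℝ) : ℝ → ℝ := C.indicator fun x => (f x)⁻¹

lemma measurable_densityWeight (hf : Measurable f) (hC : MeasurableSet C) :
    Measurable (densityWeight f C) := hf.inv.indicator hC

lemma mul_densityWeight (hc : 0 < c) (hfc : ∀ x ∈ C, c ≤ f x) (x : ℝ) :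
    f x * densityWeight f C x = C.indicator 1 x := by
  by_cases hx : x ∈ C
  · simp [densityWeight, hx, (hc.trans_le (hfc x hx)).ne']
  · simp [densityWeight, hx]

lemma abs_densityWeight_le (hc : 0 < c) (hfc : ∀ x ∈ C, c ≤ f x) (x : ℝ) :
    |densityWeight f C x| ≤ c⁻¹ := by
  by_cases hx : x ∈ C
  · have := hc.trans_le (hfc x hx)
    simp only [densityWeight, hx, Set.indicator_of_mem]
    rw [abs_of_pos (inv_pos.2 this)]
    exact inv_anti₀ hc (hfc x hx)
  · simp [densityWeight, hx, hc.le]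

/-- A kernel `w` with negative integral produces, at every small bandwidth, finite samples from the
density `f` whose weighted pair sum is negative with positive probability. -/
lemma exists_bandwidth_pi_sum_neg_pos (hf : IsProbDensity f) (hC : IsCompact C)
    (hCpos : 0 < volume C) (hc : 0 < c) (hfc : ∀ x ∈ C, c ≤ f x) {w : ℝ → ℝ} (hw : Integrable w)
    (hneg : ∫ u, w u < 0) :
    ∃ h₀ : ℝ, 0 < h₀ ∧ ∀ h : ℝ, 0 < h → h < h₀ → ∃ m : ℕ,
      0 < Measure.pi (fun _ : Fin m => volume.withDensity fun x => ENNReal.ofReal (f x))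
        {x | ∑ i, ∑ j, densityWeight f C (x i) * densityWeight f C (x j) *
          w ((x i - x j) / h) < 0} := by
  obtain ⟨h₀, hh₀, H⟩ := exists_integral_indicator_mul_neg hC hCpos hw hneg
  refine ⟨h₀, hh₀, fun h hpos hlt => ?_⟩
  have hJ := H h hpos hlt
  have hI := integrable_indicator_mul hC hw hpos
  have := isProbabilityMeasure_withDensity hf
  set μ := volume.withDensity fun x => ENNReal.ofReal (f x) with hμ
  have hfm : Measurable fun x => ENNReal.ofReal (f x) := hf.measurable.ennreal_ofReal
  -- the densities cancel the weights and leave Lebesgue measure on `C × C`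
  have hprod : μ.prod μ = (volume.prod volume).withDensity fun z : ℝ × ℝ =>
      ENNReal.ofReal (f z.1) * ENNReal.ofReal (f z.2) := prod_withDensity hfm hfm
  have hfm2 : Measurable fun z : ℝ × ℝ => ENNReal.ofReal (f z.1) * ENNReal.ofReal (f z.2) :=
    (hfm.comp measurable_fst).mul (hfm.comp measurable_snd)
  have hlt2 : ∀ᵐ z ∂((volume : Measure ℝ).prod volume),
      ENNReal.ofReal (f z.1) * ENNReal.ofReal (f z.2) < ⊤ :=
    ae_of_all _ fun z => ENNReal.mul_lt_top ENNReal.ofReal_lt_top ENNReal.ofReal_lt_top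
  have hpt : ∀ z : ℝ × ℝ, (ENNReal.ofReal (f z.1) * ENNReal.ofReal (f z.2)).toReal •
      (densityWeight f C z.1 * densityWeight f C z.2 * w ((z.1 - z.2) / h)) =
      C.indicator 1 z.1 * C.indicator 1 z.2 * w ((z.1 - z.2) / h) := fun z => by
    rw [ENNReal.toReal_mul, ENNReal.toReal_ofReal (hf.nonneg _), ENNReal.toReal_ofReal
      (hf.nonneg _), smul_eq_mul, ← mul_densityWeight hc hfc, ← mul_densityWeight hc hfc]
    ring
  have hφm := measurable_densityWeight hf.measurable hC.measurableSet
  refine exists_pi_sum_neg_pos μ (G := fun z => densityWeight f C z.1 * densityWeight f C z.2 *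
    w ((z.1 - z.2) / h)) ?_ ?_ ?_
  · rw [hprod, integrable_withDensity_iff_integrable_smul' hfm2 hlt2]
    exact hI.congr (ae_of_all _ fun z => (hpt z).symm)
  · simp only [sub_self]
    refine Integrable.mul_const ?_ _
    refine Integrable.of_bound (hφm.mul hφm).aestronglyMeasurable (c⁻¹ * c⁻¹)
      (ae_of_all _ fun x => ?_)
    rw [Real.norm_eq_abs, abs_mul]
    exact mul_le_mul (abs_densityWeight_le hc hfc x) (abs_densityWeight_le hc hfc x)
      (abs_nonneg _) (inv_nonneg.2 hc.le)
  · rw [hprod, integral_withDensity_eq_integral_toReal_smul hfm2 hlt2]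
    simp only [hpt]
    exact hJ

end Density

/-- Two points at a scaled distance where `K` exceeds `K 0` give the form a negative value, at the
difference of the two unit vectors. -/
lemma exists_sum_neg_of_lt {K : ℝ → ℝ} (heven : ∀ x, K (-x) = K x) {h : ℝ} {m : ℕ} {x : Fin m → ℝ}
    {i j : Fin m} (hij : K 0 < K ((x i - x j) / h)) :
    ∃ v : Fin m → ℝ, ∑ a, ∑ b, K ((x a - x b) / h) * v a * v b < 0 := by
  have hK : K ((x j - x i) / h) = K ((x i - x j) / h) := by
    rw [← heven, ← neg_div, neg_sub]
  refine ⟨Pi.single i 1 - Pi.single j 1, ?_⟩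
  have : ∑ a, ∑ b, K ((x a - x b) / h) * (Pi.single i 1 - Pi.single j 1 : Fin m → ℝ) a *
      (Pi.single i 1 - Pi.single j 1 : Fin m → ℝ) b = 2 * K 0 - 2 * K ((x i - x j) / h) := by
    simp [mul_sub, Finset.sum_sub_distrib, Pi.single_apply, hK]
    ring
  rw [this]
  linarith

/-- If the sum with the factor `cos (a i - a j)` is negative, then so is the quadratic form at one
of the vectors `φ cos a`, `φ sin a`. -/
lemma exists_sum_neg_of_cos {m : ℕ} {k : Fin m → Fin m → ℝ} {φ a : Fin m → ℝ}
    (h : ∑ i, ∑ j, φ i * φ j * (k i j * Real.cos (a i - a j)) < 0) :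
    ∃ v : Fin m → ℝ, ∑ i, ∑ j, k i j * v i * v j < 0 := by
  by_contra! H
  have h1 := H fun i => φ i * Real.cos (a i)
  have h2 := H fun i => φ i * Real.sin (a i)
  refine absurd (add_nonneg h1 h2) (not_le.2 (lt_of_eq_of_lt ?_ h))
  simp only [← Finset.sum_add_distrib]
  refine Finset.sum_congr rfl fun i _ => Finset.sum_congr rfl fun j _ => ?_
  rw [Real.cos_sub]
  ring

/-- If `K` is not almost everywhere the transform of a finite positive measure, then at every small
bandwidth a sample of some fixed size lies with positive probability in a set of design points at
which the quadratic form of `K` is indefinite. Either `K` exceeds `K 0` on a set of positive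
measure, and two points suffice; or `K` is essentially bounded, and its Fourier transform has a
negative value. -/
lemma exists_bandwidth_exists_indefinite {K : ℝ → ℝ} (hK : ∀ x, 0 ≤ K x)
    (heven : ∀ x, K (-x) = K x) (hKm : Measurable K) (hKi : Integrable K)
    (hnot : ¬ ∃ K' : ℝ → ℝ, K' =ᵐ[volume] K ∧ IsTransformOfPosFiniteMeasure K')
    {f : ℝ → ℝ} {C : Set ℝ} {c : ℝ} (hf : IsProbDensity f) (hC : IsCompact C)
    (hCpos : 0 < volume C) (hc : 0 < c) (hfc : ∀ x ∈ C, c ≤ f x) :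
    ∃ h₀ : ℝ, 0 < h₀ ∧ ∀ h : ℝ, 0 < h → h < h₀ → ∃ (m : ℕ) (B : Set (Fin m → ℝ)),
      MeasurableSet B ∧
      0 < Measure.pi (fun _ : Fin m => volume.withDensity fun x => ENNReal.ofReal (f x)) B ∧
      ∀ x ∈ B, ∃ v : Fin m → ℝ, ∑ i, ∑ j, K ((x i - x j) / h) * v i * v j < 0 := by
  have hφm := measurable_densityWeight hf.measurable hC.measurableSet
  have hmeas : ∀ (w : ℝ → ℝ), Measurable w → ∀ (h : ℝ) (m : ℕ), MeasurableSet
      {x : Fin m → ℝ | ∑ i, ∑ j, densityWeight f C (x i) * densityWeight f C (x j) *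
          w ((x i - x j) / h) < 0} := fun w hw h m =>
    measurableSet_lt (by fun_prop) measurable_const
  by_cases hM : ∀ᵐ x, K x ≤ K 0
  · have hξ : ∃ ξ, cosTransform K ξ < 0 := by
      by_contra! hpos
      exact hnot (exists_isTransformOfPosFiniteMeasure hKi heven hM hpos)
    obtain ⟨ξ, hξ⟩ := hξ
    have hwm : Measurable fun u => K u * Real.cos (2 * Real.pi * ξ * u) := by fun_prop
    have hw : Integrable fun u => K u * Real.cos (2 * Real.pi * ξ * u) :=
      hKi.mul_bdd (c := 1) (by fun_prop) (ae_of_all _ fun x => Real.abs_cos_le_one _)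
    obtain ⟨h₀, hh₀, H⟩ := exists_bandwidth_pi_sum_neg_pos hf hC hCpos hc hfc hw hξ
    refine ⟨h₀, hh₀, fun h hpos hlt => ?_⟩
    obtain ⟨m, hm⟩ := H h hpos hlt
    refine ⟨m, _, hmeas _ hwm h m, hm, fun x hx => ?_⟩
    refine exists_sum_neg_of_cos (φ := fun i => densityWeight f C (x i))
      (a := fun i => 2 * Real.pi * ξ * (x i / h)) ?_
    simp only [← mul_sub, ← sub_div]
    exact hx
  · have hwm : Measurable fun u => -max (K u - K 0) 0 := by fun_prop
    have hw : Integrable fun u => -max (K u - K 0) 0 := by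
      refine hKi.mono' hwm.aestronglyMeasurable (ae_of_all _ fun u => ?_)
      rw [norm_neg, Real.norm_of_nonneg (le_max_right _ _)]
      exact max_le (by linarith [hK 0]) (hK u)
    have hneg : ∫ u, -max (K u - K 0) 0 < 0 := by
      rw [integral_neg, neg_lt_zero]
      refine lt_of_le_of_ne (integral_nonneg fun u => le_max_right _ _) fun h0 => hM ?_
      have h1 := (integral_eq_zero_iff_of_nonneg (fun u => le_max_right _ _)
        (by simpa using hw.neg)).1 h0.symm
      filter_upwards [h1] with u hu
      simpa using hu
    obtain ⟨h₀, hh₀, H⟩ := exists_bandwidth_pi_sum_neg_pos hf hC hCpos hc hfc hw hneg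
    refine ⟨h₀, hh₀, fun h hpos hlt => ?_⟩
    obtain ⟨m, hm⟩ := H h hpos hlt
    refine ⟨m, _, hmeas _ hwm h m, hm, fun x hx => ?_⟩
    have hij : ∃ i j, K 0 < K ((x i - x j) / h) := by
      by_contra! hle
      rw [Set.mem_ofPred_eq] at hx
      refine absurd hx (not_lt.2 (Finset.sum_nonneg fun i _ => Finset.sum_nonneg fun j _ => ?_))
      rw [max_eq_right (sub_nonpos.2 (hle i j)), neg_zero, mul_zero]
    obtain ⟨i, j, hij⟩ := hij
    exact exists_sum_neg_of_lt heven hij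

end

/-! ### Blocks of an i.i.d. sequence -/

noncomputable section

section Blocks

variable {Ω : Type*} [MeasurableSpace Ω] {P : Measure Ω} {X : ℕ → Ω → ℝ}
  {μ : Measure ℝ} {m : ℕ} {B : Set (Fin m → ℝ)}

/-- The event that the block of indices `b * m, …, b * m + m - 1` of the sample lies in `B`. -/
def blockEvent (X : ℕ → Ω → ℝ) (B : Set (Fin m → ℝ)) (b : ℕ) : Set Ω :=
  {ω | (fun j : Fin m => X (b * m + j) ω) ∈ B}

lemma measurableSet_blockEvent (hX : ∀ i, Measurable (X i)) (hB : MeasurableSet B) (b : ℕ) :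
    MeasurableSet (blockEvent X B b) :=
  (measurable_pi_lambda _ fun j : Fin m => hX (b * m + j)) hB

lemma measure_blockEvent (hX : ∀ i, Measurable (X i)) (hind : iIndepFun X P)
    (hlaw : ∀ i, P.map (X i) = μ) (hB : MeasurableSet B) (b : ℕ) :
    P (blockEvent X B b) = Measure.pi (fun _ : Fin m => μ) B := by
  have hinj : Function.Injective fun j : Fin m => b * m + (j : ℕ) := fun i j hij =>
    Fin.ext (Nat.add_left_cancel hij)
  have h1 := (hind.precomp hinj).map_fun_eq_pi_map fun j => (hX _).aemeasurable
  simp only [hlaw] at h1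
  rw [← h1, Measure.map_apply (measurable_pi_lambda _ fun j : Fin m => hX (b * m + j)) hB]
  rfl

/-- Disjoint blocks of an i.i.d. sequence are independent, so that they all avoid `B` with
probability `(1 - p) ^ N`. -/
lemma measure_iInter_compl_blockEvent [IsProbabilityMeasure P]
    (hX : ∀ i, Measurable (X i)) (hind : iIndepFun X P) (hlaw : ∀ i, P.map (X i) = μ)
    (hB : MeasurableSet B) (N : ℕ) :
    P {ω | ∀ b < N, ω ∉ blockEvent X B b} = (1 - Measure.pi (fun _ : Fin m => μ) B) ^ N := by
  induction N with
  | zero => simp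
  | succ N ih =>
    have hdisj : Disjoint (Finset.range (N * m)) (Finset.Ico (N * m) (N * m + m)) := by
      rw [Finset.disjoint_left]
      intro a ha hb
      simp only [Finset.mem_range, Finset.mem_Ico] at ha hb
      omega
    have hi := hind.indepFun_finset _ _ hdisj hX
    have hlt : ∀ {b}, b < N → ∀ j : Fin m, b * m + (j : ℕ) ∈ Finset.range (N * m) := by
      intro b hb j
      rw [Finset.mem_range]
      calc b * m + j < b * m + m := by omega
        _ = (b + 1) * m := by ring
        _ ≤ N * m := Nat.mul_le_mul_right m hb
    have hmem : ∀ j : Fin m, N * m + (j : ℕ) ∈ Finset.Ico (N * m) (N * m + m) := by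
      intro j
      rw [Finset.mem_Ico]
      omega
    set S : Set (Finset.range (N * m) → ℝ) :=
      {y | ∀ b, ∀ hb : b < N, (fun j : Fin m => y ⟨b * m + j, hlt hb j⟩) ∈ Bᶜ} with hS
    set T : Set (Finset.Ico (N * m) (N * m + m) → ℝ) :=
      {y | (fun j : Fin m => y ⟨N * m + j, hmem j⟩) ∈ Bᶜ} with hT
    have hSm : MeasurableSet S := by
      have : S = ⋂ b, ⋂ hb : b < N, (fun (y : Finset.range (N * m) → ℝ) (j : Fin m) =>
          y ⟨b * m + j, hlt hb j⟩) ⁻¹' Bᶜ := by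
        ext y
        simp [hS]
      rw [this]
      exact MeasurableSet.iInter fun b => MeasurableSet.iInter fun hb =>
        (measurable_pi_lambda _ fun j => measurable_pi_apply _) hB.compl
    have hTm : MeasurableSet T := (measurable_pi_lambda _ fun j => measurable_pi_apply _) hB.compl
    have h1 := hi.measure_inter_preimage_eq_mul S T hSm hTm
    have h2 : {ω | ∀ b < N + 1, ω ∉ blockEvent X B b} =
        (fun a (i : Finset.range (N * m)) => X i a) ⁻¹' S ∩
          (fun a (i : Finset.Ico (N * m) (N * m + m)) => X i a) ⁻¹' T := by
      ext ω
      simp only [Nat.lt_succ_iff_lt_or_eq, or_imp, forall_and, forall_eq]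
      rfl
    have h3 : (fun a (i : Finset.Ico (N * m) (N * m + m)) => X i a) ⁻¹' T =
        (blockEvent X B N)ᶜ := rfl
    have h4 : (fun a (i : Finset.range (N * m)) => X i a) ⁻¹' S =
        {ω | ∀ b < N, ω ∉ blockEvent X B b} := rfl
    rw [h2, h1, h3, h4, ih, prob_compl_eq_one_sub (measurableSet_blockEvent hX hB N),
      measure_blockEvent hX hind hlaw hB, pow_succ]

/-- If `B` has positive probability then some block among the first `n` sample points lies in `B`
with probability tending to one. -/
lemma tendsto_measure_exists_blockEvent [IsProbabilityMeasure P]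
    (hX : ∀ i, Measurable (X i)) (hind : iIndepFun X P) (hlaw : ∀ i, P.map (X i) = μ)
    (hB : MeasurableSet B) (hpos : 0 < Measure.pi (fun _ : Fin m => μ) B) :
    Tendsto (fun n : ℕ => P {ω | ∃ b, b * m + m ≤ n ∧ ω ∈ blockEvent X B b}) atTop (𝓝 1) := by
  set p := Measure.pi (fun _ : Fin m => μ) B with hp
  have hU : P {ω | ∃ b, ω ∈ blockEvent X B b} = 1 := by
    have hm : MeasurableSet {ω | ∃ b, ω ∈ blockEvent X B b} := by
      have : {ω | ∃ b, ω ∈ blockEvent X B b} = ⋃ b, blockEvent X B b := by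
        ext ω
        simp
      rw [this]
      exact MeasurableSet.iUnion fun b => measurableSet_blockEvent hX hB b
    rw [← prob_compl_eq_zero_iff hm]
    have h1 : Tendsto (fun N : ℕ => (1 - p) ^ N) atTop (𝓝 0) :=
      ENNReal.tendsto_pow_atTop_nhds_zero_of_lt_one
        (ENNReal.sub_lt_self ENNReal.one_ne_top one_ne_zero hpos.ne')
    refine le_antisymm (ge_of_tendsto' h1 fun N => ?_) zero_le
    rw [← measure_iInter_compl_blockEvent hX hind hlaw hB]
    exact measure_mono fun ω hω b _ hb => hω ⟨b, hb⟩
  have hmono : Monotone fun n : ℕ => {ω | ∃ b, b * m + m ≤ n ∧ ω ∈ blockEvent X B b} :=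
    fun n n' hn ω ⟨b, hb, hω⟩ => ⟨b, hb.trans hn, hω⟩
  have h2 := tendsto_measure_iUnion_atTop (μ := P) hmono
  have h3 : ⋃ n : ℕ, {ω | ∃ b, b * m + m ≤ n ∧ ω ∈ blockEvent X B b} =
      {ω | ∃ b, ω ∈ blockEvent X B b} := by
    ext ω
    simp only [Set.mem_iUnion, Set.mem_ofPred_eq]
    exact ⟨fun ⟨_, b, _, hω⟩ => ⟨b, hω⟩, fun ⟨b, hω⟩ => ⟨_, b, le_rfl, hω⟩⟩
  rwa [h3, hU] at h2

end Blocks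

/-- A vector on which the form of a principal submatrix is negative, extended by zero. -/
lemma exists_sum_neg_of_injective {m n : ℕ} {k : Fin n → Fin n → ℝ} {e : Fin m → Fin n}
    (he : Function.Injective e) {v : Fin m → ℝ}
    (hv : ∑ i, ∑ j, k (e i) (e j) * v i * v j < 0) :
    ∃ w : Fin n → ℝ, ∑ i, ∑ j, k i j * w i * w j < 0 := by
  refine ⟨Function.extend e v 0, ?_⟩
  have hsum : ∀ g : Fin n → ℝ, ∑ i, g i * Function.extend e v 0 i = ∑ a, g (e a) * v a := by
    intro g
    rw [← Finset.sum_subset (Finset.subset_univ (Finset.univ.map ⟨e, he⟩)), Finset.sum_map]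
    · simp [he.extend_apply]
    · intro i _ hi
      rw [Function.extend_apply', Pi.zero_apply, mul_zero]
      rintro ⟨a, rfl⟩
      exact hi (by simp)
  have h1 : ∀ i, ∑ j, k i j * Function.extend e v 0 i * Function.extend e v 0 j =
      (∑ a, k i (e a) * v a) * Function.extend e v 0 i := by
    intro i
    rw [hsum, Finset.sum_mul]
    exact Finset.sum_congr rfl fun a _ => by ring
  simp only [h1]
  rw [hsum]
  refine lt_of_eq_of_lt (Finset.sum_congr rfl fun i _ => ?_) hv
  rw [Finset.sum_mul]
  exact Finset.sum_congr rfl fun j _ => by ring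

end

/-! ### Spectra of Nadaraya–Watson smoothers -/

theorem theorem4 (K : ℝ → ℝ) (hK_nonneg : ∀ x, 0 ≤ K x) :
    (IsTransformOfPosFiniteMeasure K →
      ∀ (n : ℕ) (x : Fin n → ℝ) (h : ℝ), 0 < h →
        complexSpectrum (nwMatrix K h x) ⊆ (fun r : ℝ => (r : ℂ)) '' Set.Icc 0 1) ∧
    ((∀ x, K (-x) = K x) → Measurable K → Integrable K →
      (¬ ∃ K' : ℝ → ℝ, K' =ᵐ[volume] K ∧ IsTransformOfPosFiniteMeasure K') →
      ∀ (f : ℝ → ℝ), IsProbDensity f →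
      ∀ (C : Set ℝ) (c : ℝ), IsCompact C → 0 < volume C → 0 < c → (∀ x ∈ C, c ≤ f x) →
        ∃ h₀ : ℝ, 0 < h₀ ∧ ∀ h : ℝ, 0 < h → h < h₀ →
          ∀ (Ω : Type*) [MeasurableSpace Ω] (P : Measure Ω) [IsProbabilityMeasure P]
            (X : ℕ → Ω → ℝ), IsIIDWithDensity P X f →
            Tendsto
              (fun n : ℕ => P {ω | ∃ r : ℝ, 1 < r ∧
                IsMaxOfSpectrum (1 - nwMatrix K h (fun i : Fin n => X i ω)) r})
              atTop (𝓝 1)) := by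
  refine ⟨fun hKt n x h hh => complexSpectrum_nwMatrix_subset hK_nonneg hKt x hh, ?_⟩
  intro heven hKm hKi hnot f hf C c hC hCpos hc hfc
  obtain ⟨h₀, hh₀, H⟩ :=
    exists_bandwidth_exists_indefinite hK_nonneg heven hKm hKi hnot hf hC hCpos hc hfc
  refine ⟨h₀, hh₀, fun h hpos hlt Ω _ P _ X hX => ?_⟩
  obtain ⟨m, B, hB, hBpos, hform⟩ := H h hpos hlt
  refine tendsto_of_tendsto_of_tendsto_of_le_of_le
    (tendsto_measure_exists_blockEvent hX.measurable hX.indep hX.law hB hBpos)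
    tendsto_const_nhds (fun n => measure_mono ?_) fun n => prob_le_one
  rintro ω ⟨b, hb, hω⟩
  obtain ⟨v, hv⟩ := hform _ hω
  obtain ⟨w, hw⟩ := exists_sum_neg_of_injective
    (k := fun i j : Fin n => K ((X i ω - X j ω) / h))
    (e := fun j : Fin m => ⟨b * m + j, by omega⟩)
    (fun i j hij => Fin.ext (Nat.add_left_cancel (Fin.mk.inj_iff.1 hij))) hv
  exact exists_isMaxOfSpectrum_one_sub_nwMatrix hK_nonneg heven hpos hw
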